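/- Let $R$ be an associative ring with $1$. For a left (resp. right) $R$-module $M$ let $M^*=\mathrm{Hom}_{\mathbb Z}(M,\mathbb Q/\mathbb Z)$, a right (resp. left) $R$-module, and for a class $\mathcal X$ of modules let $\mathcal X^*$ be the class of modules isomorphic to $M^*$ for some $M\in\mathcal X$. All classes of modules are closed under isomorphism. Write $\mathrm{Prod}(\mathcal X)$ for the closure of $\mathcal X$ under direct products and direct summands, $\mathrm{Prod}^+(\mathcal X)$ for its closure under direct products and pure submodules, $\mathcal X^+$ for its closure under pure submodules, and $\mathrm{Pinj}(\mathcal X)$ for the class of pure-injective modules in $\mathcal X$. A class of modules is a *definable subcategory* if it is closed under direct products, direct limits and pure submodules; its *elementary dual* is $\mathcal X^d=(\mathcal X^*)^+$. For classes $\mathcal S$ and $\mathcal P$ of modules on opposite sides, $(\mathcal S,\mathcal P)$ is an *almost dual pair* if $\mathcal P=\mathrm{Prod}(\mathcal P)$, $\mathcal P$ is closed under pure-injective hulls, and $M\in\mathcal S\iff M^*\in\mathcal P$ for every module $M$ on the side of $\mathcal S$. It is a *dual pair* if moreover $\mathrm{Prod}(\mathcal S^*)=\mathrm{Pinj}(\mathcal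 P)$. A *dual pair of definable categories* is a dual pair $(\mathcal S,\mathcal P)$ in which $\mathcal S$ and $\mathcal P$ are definable subcategories and $\mathcal P=\mathcal S^d$. **Corollary 4.6.** If $\mathcal S$ is a definable subcategory of $R\text{-Mod}$, then both $(\mathcal S,\mathrm{Prod}^+(\mathcal S^*))$ and $(\mathrm{Prod}^+(\mathcal S^*),\mathcal S)$ are dual pairs of definable categories. -/

import Mathlib

open CategoryTheory

universe u v w w₁ w₂

/- Conventions. Left modules over a ring `A` are objects of `ModuleCat A`; right `R`-modules are
left modules over `Rᵐᵒᵖ`. Classes (full subcategories) of modules are predicates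
`ObjectProperty (ModuleCat A)`. -/

/-! ### Purity -/

/-- A linear map `f : M → N` is a pure monomorphism: it is injective, and every finite system of
linear equations with constants in `M` that is solvable in `N` is already solvable in `M`. -/
def IsPureMono {A : Type u} [Ring A] {M : Type w₁} {N : Type w₂} [AddCommGroup M] [Module A M]
    [AddCommGroup N] [Module A N] (f : M →ₗ[A] N) : Prop :=
  Function.Injective f ∧
    ∀ (m n : ℕ) (r : Fin m → Fin n → A) (b : Fin m → M),
      (∃ y : Fin n → N, ∀ i, ∑ j, r i j • y j = f (b i)) →
        ∃ x : Fin n → M, ∀ i, ∑ j, r i j • x j = b i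

/-- A module is pure-injective if it is injective with respect to pure monomorphisms. -/
def IsPureInjective {A : Type u} [Ring A] (N : ModuleCat.{w} A) : Prop :=
  ∀ (L M : ModuleCat.{w} A) (f : L →ₗ[A] M), IsPureMono f →
    ∀ g : L →ₗ[A] N, ∃ h : M →ₗ[A] N, h ∘ₗ f = g

/-- `j : M → H` is a pure-injective hull of `M`: a pure embedding in a pure-injective module which
is pure-essential. -/
structure IsPureInjectiveHull {A : Type u} [Ring A] {M H : ModuleCat.{w} A}
    (j : M →ₗ[A] H) : Prop where
  isPureMono : IsPureMono j
  isPureInjective : IsPureInjective H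
  pureEssential : ∀ (N : ModuleCat.{w} A) (g : H →ₗ[A] N), IsPureMono (g ∘ₗ j) → IsPureMono g

/-! ### Closure operators on classes of modules -/

/-- `Prod(X)`: the closure of `X` under direct products and direct summands. -/
inductive ProdClosure {A : Type u} [Ring A] (X : ObjectProperty (ModuleCat.{w} A)) :
    ObjectProperty (ModuleCat.{w} A)
  | of (M : ModuleCat.{w} A) : X M → ProdClosure X M
  | pi (I : Type w) (M : I → ModuleCat.{w} A) :
      (∀ i, ProdClosure X (M i)) → ProdClosure X (ModuleCat.of A (∀ i, M i))
  | summand (M N : ModuleCat.{w} A) (s : M →ₗ[A] N) (p : N →ₗ[A] M) :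
      p ∘ₗ s = LinearMap.id → ProdClosure X N → ProdClosure X M

/-- `Prod⁺(X)`: the closure of `X` under direct products and pure submodules. -/
inductive ProdPlus {A : Type u} [Ring A] (X : ObjectProperty (ModuleCat.{w} A)) :
    ObjectProperty (ModuleCat.{w} A)
  | of (M : ModuleCat.{w} A) : X M → ProdPlus X M
  | pi (I : Type w) (M : I → ModuleCat.{w} A) :
      (∀ i, ProdPlus X (M i)) → ProdPlus X (ModuleCat.of A (∀ i, M i))
  | pure (M N : ModuleCat.{w} A) (f : M →ₗ[A] N) : IsPureMono f → ProdPlus X N → ProdPlus X M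

/-- `X⁺`: the closure of `X` under pure submodules (a pure submodule of a pure submodule is a
pure submodule, so one step suffices). -/
def PureSub {A : Type u} [Ring A] (X : ObjectProperty (ModuleCat.{w} A)) :
    ObjectProperty (ModuleCat.{w} A) :=
  fun M => ∃ (N : ModuleCat.{w} A) (f : M →ₗ[A] N), IsPureMono f ∧ X N

/-- `Pinj(X)`: the pure-injective modules in `X`. -/
def Pinj {A : Type u} [Ring A] (X : ObjectProperty (ModuleCat.{w} A)) :
    ObjectProperty (ModuleCat.{w} A) :=
  fun M => X M ∧ IsPureInjective M

/-- A definable subcategory: a class of modules closed under direct products, direct limits (of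
directed systems indexed by nonempty directed preorders) and pure submodules. Closure under
isomorphism is contained in closure under pure submodules. -/
structure IsDefinable {A : Type u} [Ring A] (X : ObjectProperty (ModuleCat.{w} A)) : Prop where
  pi_mem : ∀ (I : Type w) (M : I → ModuleCat.{w} A), (∀ i, X (M i)) →
    X (ModuleCat.of A (∀ i, M i))
  directLimit_mem : ∀ (I : Type w) [Preorder I] [IsDirectedOrder I] [Nonempty I] [DecidableEq I]
    (G : I → ModuleCat.{w} A) (f : ∀ i j, i ≤ j → G i →ₗ[A] G j)
    [DirectedSystem (fun i => (G i : Type w)) (fun i j h => f i j h)],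
    (∀ i, X (G i)) → X (ModuleCat.of A (Module.DirectLimit (fun i => (G i : Type w)) f))
  pure_mem : ∀ (M N : ModuleCat.{w} A) (f : M →ₗ[A] N), IsPureMono f → X N → X M

/-! ### Duals and dual pairs -/

section Dual

variable {A : Type u} [Ring A] {B : Type v} [Ring B]

/-- For an identification `e` of `B` with the opposite of `A` and a left `A`-module `M`, the
`B`-module structure on `Hom_ℤ(M, ℚ/ℤ)` given by `(b • f) m = f (a m)`, where `a : A` corresponds
to `b`. -/
@[reducible]
def dualModule (e : B ≃+* Aᵐᵒᵖ) (M : Type w) [AddCommGroup M] [Module A M] :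
    Module B (CharacterModule M) where
  smul b f := AddMonoidHom.comp f (DistribSMul.toAddMonoidHom M (e b).unop)
  one_smul f := by
    refine DFunLike.ext _ _ fun m => ?_
    change f ((e 1).unop • m) = f m
    simp
  mul_smul b c f := by
    refine DFunLike.ext _ _ fun m => ?_
    change f ((e (b * c)).unop • m) = f ((e c).unop • (e b).unop • m)
    simp [mul_smul]
  smul_zero b := rfl
  smul_add b f g := rfl
  add_smul b c f := by
    refine DFunLike.ext _ _ fun m => ?_
    change f ((e (b + c)).unop • m) = f ((e b).unop • m) + f ((e c).unop • m)
    simp [add_smul]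
  zero_smul f := by
    refine DFunLike.ext _ _ fun m => ?_
    change f ((e 0).unop • m) = 0
    simp

/-- The dual `M* = Hom_ℤ(M, ℚ/ℤ)` of an `A`-module `M`, as a module over `B ≅ Aᵐᵒᵖ`. With
`e = RingEquiv.refl Rᵐᵒᵖ` it sends left `R`-modules to right `R`-modules, with
`(f r)(m) = f (r m)`; with `e = RingEquiv.opOp R` it sends right `R`-modules to left `R`-modules,
with `(r f)(m) = f (m r)`. -/
def dual (e : B ≃+* Aᵐᵒᵖ) (M : ModuleCat.{w} A) : ModuleCat.{w} B :=
  @ModuleCat.of B _ (CharacterModule M) _ (dualModule e M)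

/-- The class `X* = {M* : M ∈ X}`, closed under isomorphism. -/
def dualClass (e : B ≃+* Aᵐᵒᵖ) (X : ObjectProperty (ModuleCat.{w} A)) :
    ObjectProperty (ModuleCat.{w} B) :=
  fun N => ∃ M : ModuleCat.{w} A, X M ∧ Nonempty (N ≃ₗ[B] dual e M)

/-- `(S, P)` is an almost dual pair: `P = Prod(P)`, `P` is closed under pure-injective hulls, and
`M ∈ S ↔ M* ∈ P`. -/
structure IsAlmostDualPair (e : B ≃+* Aᵐᵒᵖ) (S : ObjectProperty (ModuleCat.{w} A))
    (P : ObjectProperty (ModuleCat.{w} B)) : Prop where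
  eq_prod : P = ProdClosure P
  hull_mem : ∀ (M H : ModuleCat.{w} B) (j : M →ₗ[B] H), IsPureInjectiveHull j → P M → P H
  mem_iff : ∀ M : ModuleCat.{w} A, S M ↔ P (dual e M)

/-- `(S, P)` is a dual pair: an almost dual pair such that `Prod(S*) = Pinj(P)`. -/
structure IsDualPair (e : B ≃+* Aᵐᵒᵖ) (S : ObjectProperty (ModuleCat.{w} A))
    (P : ObjectProperty (ModuleCat.{w} B)) : Prop extends IsAlmostDualPair e S P where
  prod_eq_pinj : ProdClosure (dualClass e S) = Pinj P

/-- The elementary dual `X^d = (X*)⁺` of a definable subcategory `X`. -/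
def elementaryDual (e : B ≃+* Aᵐᵒᵖ) (X : ObjectProperty (ModuleCat.{w} A)) :
    ObjectProperty (ModuleCat.{w} B) :=
  PureSub (dualClass e X)

/-- `(S, P)` is a dual pair of definable categories: a dual pair of definable subcategories, the
second of which is the elementary dual of the first. -/
structure IsDefinableDualPair (e : B ≃+* Aᵐᵒᵖ) (S : ObjectProperty (ModuleCat.{w} A))
    (P : ObjectProperty (ModuleCat.{w} B)) : Prop extends IsDualPair e S P where
  definable_left : IsDefinable S
  definable_right : IsDefinable P
  eq_elementaryDual : P = elementaryDual e S

end Dual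

/-!
A definable class `S` is given by implications between finite linear systems: for matrices
`H, G, K`, every solution `x` of `H x = 0` makes `G x = K y` solvable (`ImpliesSolvable`). Indeed,
let `N` satisfy all such implications valid in `S`, and let `r y = b` be a system with constants in
`N` which is unsolvable in `N`. Any finite set of relations of `N` can be realized in a member of
`S` with the system still unsolvable, and a reduced product of these members, a direct limit of
products, receives a homomorphism from `N` under which the system stays unsolvable
(`IsDefinable.exists_hom_unsolvable`). The product of such homomorphisms, one for every unsolvable
system, is a pure embedding of `N` in a member of `S`, so `N` is in `S`
(`IsDefinable.mem_of_impliesSolvable`).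

As `ℚ/ℤ` is an injective cogenerator, `M` satisfies the implication `(H, G, K)` if and only if `M*`
satisfies the implication `(Kᵀ, Gᵀ, Hᵀ)` (`impliesSolvable_dual_iff`). It follows that `M` is in `S`
if and only if `M**` is, and that `D = {N | N* ∈ S}` is definable. Evaluation `N → N**` is a pure
embedding, so `D` consists of the pure submodules of modules `M*` with `M` in `S`, and it equals
`Prod⁺(S*)`. Finally, dual modules are pure-injective (`isPureInjective_dual`). Hence a
pure-injective module in `D` is a direct summand of its double dual, and a pure-injective hull of a
module in `D` is a pure submodule of the double dual. The hypotheses used here on `S` and `D` are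
symmetric, and give both dual pairs (`isDefinableDualPair_of_mem_iff`).
-/

/-! ### Linear systems and implications between them -/

section Systems

variable {A : Type*} [Ring A] {M N : Type*} [AddCommGroup M] [Module A M] [AddCommGroup N]
  [Module A N] {ι κ : Type*} [Fintype κ]

/-- The action `Mᵏ → Mⁱ` of a matrix over `A` on column vectors with entries in an `A`-module. It
is only additive, since `A` need not be commutative. -/
def systemMap (H : Matrix ι κ A) (M : Type*) [AddCommGroup M] [Module A M] :
    (κ → M) →+ (ι → M) where
  toFun x i := ∑ j, H i j • x j
  map_zero' := by ext; simp
  map_add' x y := by ext; simp [smul_add, Finset.sum_add_distrib]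

theorem systemMap_apply (H : Matrix ι κ A) (x : κ → M) (i : ι) :
    systemMap H M x i = ∑ j, H i j • x j := rfl

theorem systemMap_comp (H : Matrix ι κ A) (f : M →ₗ[A] N) (x : κ → M) :
    systemMap H N (f ∘ x) = f ∘ systemMap H M x := by
  ext i
  simp [systemMap_apply]

theorem systemMap_reindex {κ' : Type*} [Fintype κ'] (H : Matrix ι κ A) (e : κ' ≃ κ) (x : κ → M) :
    systemMap (H.submatrix id e) M (x ∘ e) = systemMap H M x := by
  ext i
  simpa [systemMap_apply] using e.sum_comp fun j => H i j • x j

theorem systemMap_pi {I : Type*} {P : I → Type*} [∀ i, AddCommGroup (P i)] [∀ i, Module A (P i)]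
    (H : Matrix ι κ A) (x : κ → ∀ i, P i) (a : I) :
    (fun i => systemMap H (∀ i, P i) x i a) = systemMap H (P a) fun j => x j a := by
  ext i
  simp [systemMap_apply]

variable {p n q k : Type*} [Fintype n] [Fintype k]

/-- Every solution `x` in `M` of `H x = 0` makes `G x = K y` solvable for `y`. This says that the
pair of positive primitive formulas (`H x = 0`, and `∃ y, G x = K y`) is closed on `M`. -/
def ImpliesSolvable (H : Matrix p n A) (G : Matrix q n A) (K : Matrix q k A) (M : Type*)
    [AddCommGroup M] [Module A M] : Prop :=
  ∀ x : n → M, systemMap H M x = 0 → ∃ y : k → M, systemMap K M y = systemMap G M x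

/-- `ImpliesSolvable` only depends on the matrices up to renaming of their indices. -/
theorem ImpliesSolvable.of_reindex {p' n' : Type*} [Fintype n'] (ep : p' ≃ p)
    (en : n' ≃ n) {H : Matrix p n A} {G : Matrix q n A} {K : Matrix q k A}
    (h : ImpliesSolvable (H.submatrix ep en) (G.submatrix id en) K M) :
    ImpliesSolvable H G K M := by
  intro x hx
  obtain ⟨y, hy⟩ := h (x ∘ en) <| by
    have := congrArg (· ∘ ep) ((systemMap_reindex H en x).trans hx)
    exact this
  exact ⟨y, hy.trans (systemMap_reindex G en x)⟩

end Systems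

section Pure

variable {A : Type u} [Ring A] {M : Type w₁} {N : Type w₂} [AddCommGroup M] [Module A M]
  [AddCommGroup N] [Module A N]

/-- Injectivity of a pure monomorphism is the case of a system without unknowns. -/
theorem isPureMono_of_systems {f : M →ₗ[A] N}
    (h : ∀ (m n : ℕ) (r : Matrix (Fin m) (Fin n) A) (b : Fin m → M),
      (∃ y, systemMap r N y = f ∘ b) → ∃ x, systemMap r M x = b) : IsPureMono f := by
  refine ⟨(injective_iff_map_eq_zero f).2 fun a ha => ?_, fun m n r b ⟨y, hy⟩ => ?_⟩
  · obtain ⟨x, hx⟩ := h 1 0 0 (fun _ => a) ⟨0, by ext; simp [ha, systemMap_apply]⟩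
    simpa [systemMap_apply] using (congrFun hx 0).symm
  · obtain ⟨x, hx⟩ := h m n r b ⟨y, funext hy⟩
    exact ⟨x, congrFun hx⟩

theorem IsPureMono.exists_solution {f : M →ₗ[A] N} (hf : IsPureMono f) {ι κ : Type*} [Finite ι]
    [Fintype κ] (r : Matrix ι κ A) (b : ι → M) (y : κ → N) (hy : systemMap r N y = f ∘ b) :
    ∃ x, systemMap r M x = b := by
  cases nonempty_fintype ι
  let eι := Fintype.equivFin ι
  let eκ := Fintype.equivFin κ
  obtain ⟨x, hx⟩ := hf.2 _ _ (fun i j => r (eι.symm i) (eκ.symm j)) (b ∘ eι.symm)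
    ⟨y ∘ eκ.symm, fun i => (congrFun (systemMap_reindex r eκ.symm y) _).trans (congrFun hy _)⟩
  refine ⟨x ∘ eκ, funext fun i => ?_⟩
  rw [← systemMap_reindex r eκ.symm]
  simpa [Function.comp_def, systemMap_apply] using hx (eι i)

theorem isPureMono_of_leftInverse {s : M →ₗ[A] N} {p : N →ₗ[A] M} (h : p ∘ₗ s = LinearMap.id) :
    IsPureMono s :=
  isPureMono_of_systems fun _ _ r b ⟨y, hy⟩ =>
    ⟨p ∘ y, by rw [systemMap_comp, hy]; ext i; exact LinearMap.congr_fun h (b i)⟩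

theorem ImpliesSolvable.of_isPureMono {f : M →ₗ[A] N} (hf : IsPureMono f) {p n q k : Type*}
    [Fintype n] [Fintype k] [Finite q] {H : Matrix p n A} {G : Matrix q n A} {K : Matrix q k A}
    (h : ImpliesSolvable H G K N) : ImpliesSolvable H G K M := by
  intro x hx
  obtain ⟨y, hy⟩ := h (f ∘ x) (by rw [systemMap_comp, hx]; ext; simp)
  exact hf.exists_solution K _ y (by rw [hy, systemMap_comp])

theorem ImpliesSolvable.pi {I : Type*} {P : I → Type*} [∀ i, AddCommGroup (P i)]
    [∀ i, Module A (P i)] {p n q k : Type*} [Fintype n] [Fintype k]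
    {H : Matrix p n A} {G : Matrix q n A} {K : Matrix q k A}
    (h : ∀ i, ImpliesSolvable H G K (P i)) : ImpliesSolvable H G K (∀ i, P i) := by
  intro x hx
  choose y hy using fun a => h a (fun j => x j a) (by rw [← systemMap_pi, hx]; rfl)
  refine ⟨fun j a => y a j, ?_⟩
  ext i a
  exact (congrFun (systemMap_pi K _ a) i).trans
    ((congrFun (hy a) i).trans (congrFun (systemMap_pi G x a) i).symm)

end Pure

/-! ### Finite systems in direct limits -/

section DirectLimit

variable {A : Type*} [Ring A] {I : Type*} [Preorder I] [IsDirectedOrder I]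
  [DecidableEq I] {P : I → Type*} [∀ i, AddCommGroup (P i)] [∀ i, Module A (P i)]
  (f : ∀ i j, i ≤ j → P i →ₗ[A] P j)

theorem exists_lift_directLimit [Nonempty I] {n : Type*} [Finite n]
    (x : n → Module.DirectLimit P f) (i₀ : I) :
    ∃ (i : I) (_ : i₀ ≤ i) (z : n → P i), Module.DirectLimit.of A I P f i ∘ z = x := by
  choose j w hw using fun a => Module.DirectLimit.exists_of (x a)
  obtain ⟨i, hi⟩ := Finite.exists_le (fun o : Option n => o.elim i₀ j)
  refine ⟨i, hi none, fun a => f _ _ (hi (some a)) (w a), funext fun a => ?_⟩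
  exact (Module.DirectLimit.of_f).trans (hw a)

theorem exists_map_eq_zero_directLimit [DirectedSystem P (fun i j h => f i j h)] {n : Type*}
    [Finite n] {i : I} (z : n → P i) (hz : Module.DirectLimit.of A I P f i ∘ z = 0) :
    ∃ (j : I) (h : i ≤ j), f i j h ∘ z = 0 := by
  choose j hj hz using fun a => Module.DirectLimit.of.zero_exact (congrFun hz a)
  have : Nonempty I := ⟨i⟩
  obtain ⟨l, hl⟩ := Finite.exists_le (fun o : Option n => o.elim i j)
  refine ⟨l, hl none, funext fun a => ?_⟩
  have h := DirectedSystem.map_map (f := fun i j h => f i j h) (hj a) (hl (some a)) (z a)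
  exact h.symm.trans (by rw [hz a, map_zero]; rfl)

theorem ImpliesSolvable.directLimit [Nonempty I] [DirectedSystem P (fun i j h => f i j h)]
    {p n q k : Type*} [Fintype n] [Fintype k] [Finite p]
    {H : Matrix p n A} {G : Matrix q n A} {K : Matrix q k A}
    (h : ∀ i, ImpliesSolvable H G K (P i)) :
    ImpliesSolvable H G K (Module.DirectLimit P f) := by
  intro x hx
  obtain ⟨i, -, z, rfl⟩ := exists_lift_directLimit f x (Classical.arbitrary I)
  rw [systemMap_comp] at hx
  obtain ⟨j, hij, hz⟩ := exists_map_eq_zero_directLimit f _ hx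
  obtain ⟨y, hy⟩ := h j (f i j hij ∘ z) (by rw [systemMap_comp, hz])
  refine ⟨Module.DirectLimit.of A I P f j ∘ y, ?_⟩
  have hc : Module.DirectLimit.of A I P f i ∘ z =
      Module.DirectLimit.of A I P f j ∘ (f i j hij ∘ z) :=
    funext fun a => Module.DirectLimit.of_f.symm
  rw [systemMap_comp, hy, hc]
  exact (systemMap_comp G _ _).symm

end DirectLimit

/-! ### Definable classes are defined by implications between linear systems -/

section Definable

/-- If a system with constants in `N` is unsolvable in `N`, then any finite set `T` of linear
relations between elements of `N` can be realized in a member of `S` with the system still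
unsolvable, provided `N` satisfies all the implications which are valid in `S`. -/
theorem exists_local_realization {A : Type u} [Ring A] {S : ObjectProperty (ModuleCat.{w} A)}
    {N : ModuleCat.{w} A}
    (hN : ∀ (p n q k : ℕ) (H : Matrix (Fin p) (Fin n) A) (G : Matrix (Fin q) (Fin n) A)
      (K : Matrix (Fin q) (Fin k) A), (∀ M, S M → ImpliesSolvable H G K M) →
        ImpliesSolvable H G K N)
    {m k : ℕ} {r : Matrix (Fin m) (Fin k) A} {b : Fin m → N} (hb : ¬∃ y, systemMap r N y = b)
    (T : Finset (LinearMap.ker (Finsupp.linearCombination A (id : N → N)))) :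
    ∃ (M : ModuleCat.{w} A) (x : N → M), S M ∧
      (∀ c ∈ T, Finsupp.linearCombination A x (c : N →₀ A) = 0) ∧
        ¬∃ y, systemMap r M y = x ∘ b := by
  classical
  let E : Finset N := Finset.univ.image b ∪ T.biUnion fun c => (c : N →₀ A).support
  -- The matrices of the relations in `T` and of the tuple `b` with respect to `E`.
  let H : Matrix T E A := fun c e => (c : N →₀ A) e
  let G : Matrix (Fin m) E A := fun i e => if (e : N) = b i then 1 else 0
  have hH : ∀ (M : ModuleCat.{w} A) (x : N → M) (c : T),
      systemMap H M (fun e => x e) c = Finsupp.linearCombination A x (c : N →₀ A) := by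
    intro M x c
    rw [Finsupp.linearCombination_apply, Finsupp.sum_of_support_subset (s := E)]
    · exact Finset.sum_coe_sort E fun e => (c : N →₀ A) e • x e
    · exact fun e he => Finset.mem_union_right _ (Finset.mem_biUnion.2 ⟨c, c.2, he⟩)
    · simp
  have hG : ∀ (M : ModuleCat.{w} A) (x : N → M), systemMap G M (fun e => x e) = x ∘ b := by
    intro M x
    ext i
    have hi : b i ∈ E := Finset.mem_union_left _ (Finset.mem_image_of_mem _ (Finset.mem_univ i))
    have := Finset.sum_coe_sort E fun e => (if e = b i then (1 : A) else 0) • x e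
    rw [systemMap_apply, this]
    simp [hi]
  by_contra! hcon
  refine hb ?_
  have key : ImpliesSolvable H G r N := by
    refine .of_reindex (Fintype.equivFin T).symm (Fintype.equivFin E).symm
      (hN _ _ _ _ _ _ _ fun M hM => ?_)
    refine .of_reindex (Fintype.equivFin T) (Fintype.equivFin E) ?_
    simp only [Matrix.submatrix_submatrix, Equiv.symm_comp_self, Function.id_comp,
      Matrix.submatrix_id_id]
    intro x hx
    let x' : N → M := fun e => if h : e ∈ E then x ⟨e, h⟩ else 0
    have hx' : x = fun e : E => x' e := by ext e; simp [x']
    rw [hx'] at hx ⊢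
    rw [hG]
    exact hcon M x' hM fun c hc => by rw [← hH M x' ⟨c, hc⟩, hx]; rfl
  obtain ⟨y, hy⟩ := key (fun e => (e : N)) <| by
    ext c
    exact (hH N id c).trans c.1.2
  exact ⟨y, hy.trans (hG N id)⟩

/-- If `N` satisfies all the implications which are valid in the definable class `S`, then a system
which is unsolvable in `N` stays unsolvable under some homomorphism from `N` to a member of `S`. -/
theorem IsDefinable.exists_hom_unsolvable {A : Type u} [Ring A]
    {S : ObjectProperty (ModuleCat.{max u v} A)} (hS : IsDefinable S) {N : ModuleCat.{max u v} A}
    (hN : ∀ (p n q k : ℕ) (H : Matrix (Fin p) (Fin n) A) (G : Matrix (Fin q) (Fin n) A)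
      (K : Matrix (Fin q) (Fin k) A), (∀ M, S M → ImpliesSolvable H G K M) →
        ImpliesSolvable H G K N)
    {m k : ℕ} {r : Matrix (Fin m) (Fin k) A} {b : Fin m → N} (hb : ¬∃ y, systemMap r N y = b) :
    ∃ (Q : ModuleCat.{max u v} A) (g : N →ₗ[A] Q), S Q ∧ ¬∃ y, systemMap r Q y = g ∘ b := by
  classical
  choose M x hM hx hr using exists_local_realization hN hb
  -- The reduced product of the `M T` along the filter generated by the sets `{T' | T ⊆ T'}`.
  let I := Finset (LinearMap.ker (Finsupp.linearCombination A (id : N → N)))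
  let P : I → ModuleCat.{max u v} A := fun T => ModuleCat.of A (∀ T' : Set.Ici T, M T')
  let f : ∀ T U : I, T ≤ U → P T →ₗ[A] P U := fun T U h =>
    LinearMap.pi fun T' : Set.Ici U => LinearMap.proj (⟨T'.1, h.trans T'.2⟩ : Set.Ici T)
  have : DirectedSystem (fun T => (P T : Type _)) (fun T U h => f T U h) :=
    ⟨fun _ _ => rfl, fun _ _ _ _ _ _ => rfl⟩
  let Q := ModuleCat.of A (Module.DirectLimit (fun T => (P T : Type _)) f)
  let o : ∀ T : I, P T →ₗ[A] Q := fun T => Module.DirectLimit.of A I (fun T => (P T : Type _)) f T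
  have ho : ∀ T U (h : T ≤ U) z, o U (f T U h z) = o T z := fun T U h z =>
    Module.DirectLimit.of_f (hij := h)
  -- A relation of `N` holds at all the indices which contain it.
  have hrel : ∀ c : LinearMap.ker (Finsupp.linearCombination A (id : N → N)),
      o ∅ (fun T' => Finsupp.linearCombination A (x T') (c : N →₀ A)) = 0 := by
    intro c
    rw [← ho ∅ {c} (Finset.empty_subset _)]
    convert map_zero (o {c})
    ext T'
    exact hx T'.1 c (T'.2 (Finset.mem_singleton_self c))
  let g : N →ₗ[A] Q :=
    { toFun := fun n => o ∅ fun T' => x T' n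
      map_add' := fun a a' => by
        have := hrel ⟨Finsupp.single (a + a') 1 - Finsupp.single a 1 - Finsupp.single a' 1,
          by simp⟩
        simp only [map_sub, Finsupp.linearCombination_single, one_smul] at this
        rw [← sub_eq_zero, ← sub_sub, ← map_sub, ← map_sub]
        exact this
      map_smul' := fun s a => by
        have := hrel ⟨Finsupp.single (s • a) 1 - Finsupp.single a s, by simp⟩
        simp only [map_sub, Finsupp.linearCombination_single, one_smul] at this
        rw [← sub_eq_zero, RingHom.id_apply, ← map_smul, ← map_sub]
        exact this }
  refine ⟨Q, g, hS.directLimit_mem I P f fun T => hS.pi_mem _ _ fun T' => hM T', ?_⟩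
  rintro ⟨y, hy⟩
  obtain ⟨T, hT, z, rfl⟩ := exists_lift_directLimit f y ∅
  obtain ⟨U, hU, h0⟩ := exists_map_eq_zero_directLimit f
    (systemMap r (P T) z - f ∅ T hT ∘ fun i T' => x T' (b i)) <| by
      ext i
      have h1 := (congrFun (systemMap_comp r (o T) z) i).symm.trans (congrFun hy i)
      have h2 := ho ∅ T hT fun T' => x T' (b i)
      exact (map_sub (o T) _ _).trans (sub_eq_zero.2 (h1.trans h2.symm))
  refine hr U ⟨fun j => z j ⟨U, hU⟩, ?_⟩
  rw [← systemMap_pi (P := fun T' : Set.Ici T => M T') r z ⟨U, hU⟩]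
  ext i
  exact sub_eq_zero.1 (congrFun (congrFun h0 i) ⟨U, le_refl U⟩)

/-- A definable class contains every module which satisfies the implications between finite linear
systems that are valid in the class. -/
theorem IsDefinable.mem_of_impliesSolvable {A : Type u} [Ring A]
    {S : ObjectProperty (ModuleCat.{max u v} A)} (hS : IsDefinable S) {N : ModuleCat.{max u v} A}
    (hN : ∀ (p n q k : ℕ) (H : Matrix (Fin p) (Fin n) A) (G : Matrix (Fin q) (Fin n) A)
      (K : Matrix (Fin q) (Fin k) A), (∀ M, S M → ImpliesSolvable H G K M) →
        ImpliesSolvable H G K N) : S N := by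
  let J := Σ m k : ℕ, {s : Matrix (Fin m) (Fin k) A × (Fin m → N) //
    ¬∃ y, systemMap s.1 N y = s.2}
  choose Q g hQ hg using fun j : J => hS.exists_hom_unsolvable hN j.2.2.2
  refine hS.pure_mem N _ (LinearMap.pi g) (isPureMono_of_systems fun m k r b ⟨y, hy⟩ => ?_)
    (hS.pi_mem J Q hQ)
  by_contra hb
  let j : J := ⟨m, k, (r, b), hb⟩
  refine hg j ⟨fun i => y i j, ?_⟩
  rw [← systemMap_pi (P := fun j => Q j) r y j, hy]
  rfl

/-- Each family of implications between finite linear systems defines a definable class. -/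
theorem isDefinable_of_iff_impliesSolvable {A : Type u} [Ring A]
    {S : ObjectProperty (ModuleCat.{w} A)} {J : Sort*} {p n q k : J → ℕ}
    (H : ∀ j, Matrix (Fin (p j)) (Fin (n j)) A) (G : ∀ j, Matrix (Fin (q j)) (Fin (n j)) A)
    (K : ∀ j, Matrix (Fin (q j)) (Fin (k j)) A)
    (h : ∀ M, S M ↔ ∀ j, ImpliesSolvable (H j) (G j) (K j) M) : IsDefinable S where
  pi_mem _ _ hM := (h _).2 fun j => .pi fun i => (h _).1 (hM i) j
  directLimit_mem _ _ _ _ _ _ f _ hP := (h _).2 fun j => .directLimit f fun i => (h _).1 (hP i) j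
  pure_mem _ _ _ hf hN := (h _).2 fun j => .of_isPureMono hf ((h _).1 hN j)

end Definable

/-! ### Characters of abelian groups -/

section Character

variable {X Y : Type*} [AddCommGroup X] [AddCommGroup Y]

theorem exists_character_extension (α : X →+ Y) (χ : X →+ AddCircle (1 : ℚ))
    (h : ∀ x, α x = 0 → χ x = 0) : ∃ ψ : Y →+ AddCircle (1 : ℚ), ∀ x, ψ (α x) = χ x := by
  obtain ⟨ψ, hψ⟩ := CharacterModule.dual_surjective_of_injective
    (QuotientAddGroup.kerLift α).toIntLinearMap (QuotientAddGroup.kerLift_injective α)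
    (QuotientAddGroup.lift α.ker χ h)
  exact ⟨ψ, fun x => DFunLike.congr_fun hψ (x : X ⧸ α.ker)⟩

theorem exists_character_ne_zero_of_notMem_range (α : X →+ Y) {y : Y} (hy : y ∉ Set.range α) :
    ∃ χ : Y →+ AddCircle (1 : ℚ), (∀ x, χ (α x) = 0) ∧ χ y ≠ 0 := by
  obtain ⟨c, hc⟩ : ∃ c : (Y ⧸ α.range) →+ AddCircle (1 : ℚ), c (y : Y ⧸ α.range) ≠ 0 :=
    CharacterModule.exists_character_apply_ne_zero_of_ne_zero
      (mt (QuotientAddGroup.eq_zero_iff y).1 hy)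
  refine ⟨c.comp (QuotientAddGroup.mk' α.range), fun x => ?_, hc⟩
  have : (QuotientAddGroup.mk' α.range) (α x) = 0 := (QuotientAddGroup.eq_zero_iff _).2 ⟨x, rfl⟩
  rw [AddMonoidHom.comp_apply, this, map_zero]

end Character

/-! ### Dual modules and systems of equations -/

section Dual

variable {A : Type u} [Ring A] {B : Type v} [Ring B] (e : B ≃+* Aᵐᵒᵖ) (M : ModuleCat.{w} A)

/-- The elements of the dual module, as characters of the underlying group. -/
def dualChar : dual e M ≃+ (M →+ AddCircle (1 : ℚ)) := AddEquiv.refl _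

variable {M}

theorem dualChar_smul (b : B) (f : dual e M) (m : M) :
    dualChar e M (b • f) m = dualChar e M f ((e b).unop • m) := rfl

variable {ι κ : Type*}

/-- The transpose of a matrix over `A`, as a matrix over `B ≅ Aᵐᵒᵖ`. -/
def dualMatrix (H : Matrix ι κ A) : Matrix κ ι B := fun j i => e.symm (MulOpposite.op (H i j))

/-- A finite tuple of elements of the dual of `M`, as a character of a finite power of `M`. -/
def pairing [Fintype ι] (u : ι → dual e M) : (ι → M) →+ AddCircle (1 : ℚ) :=
  ∑ i, (dualChar e M (u i)).comp (Pi.evalAddMonoidHom _ i)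

theorem pairing_apply [Fintype ι] (u : ι → dual e M) (x : ι → M) :
    pairing e u x = ∑ i, dualChar e M (u i) (x i) := by
  simp [pairing]

/-- The action of the transpose of a matrix on tuples of dual elements is adjoint to the action of
the matrix. -/
theorem pairing_systemMap [Fintype ι] [Fintype κ] (H : Matrix ι κ A) (u : ι → dual e M)
    (x : κ → M) :
    pairing e u (systemMap H M x) = pairing e (systemMap (dualMatrix e H) (dual e M) u) x := by
  simp only [pairing_apply, systemMap_apply, map_sum, AddMonoidHom.finsetSum_apply,
    dualChar_smul, dualMatrix, RingEquiv.apply_symm_apply, MulOpposite.unop_op]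
  exact Finset.sum_comm

theorem exists_pairing_eq [Fintype ι] (χ : (ι → M) →+ AddCircle (1 : ℚ)) :
    ∃ u : ι → dual e M, pairing e u = χ := by
  classical
  refine ⟨fun i => (dualChar e M).symm (χ.comp (AddMonoidHom.single (fun _ => M) i)), ?_⟩
  refine DFunLike.ext _ _ fun x => ?_
  simp only [pairing_apply, AddEquiv.apply_symm_apply, AddMonoidHom.comp_apply, ← map_sum]
  congr 1
  exact Finset.univ_sum_single x

theorem pairing_injective [Fintype ι] : Function.Injective (pairing e (M := M) (ι := ι)) := by
  classical
  intro u u' h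
  ext i
  refine (dualChar e M).injective (DFunLike.ext _ _ fun m => ?_)
  have hs : ∀ w : ι → dual e M, pairing e w (Pi.single i m) = dualChar e M (w i) m := by
    intro w
    rw [pairing_apply, Finset.sum_eq_single i (fun j _ hj => by simp [hj]) (by simp)]
    simp
  rw [← hs, ← hs, h]

variable {p n q k : Type*} [Fintype p] [Fintype n] [Fintype q] [Fintype k]

/-- Elementary duality: transposing the matrices of an implication between linear systems, and
exchanging the hypothesis with the existential part of the conclusion, corresponds to taking
character modules. -/
theorem impliesSolvable_dual_iff (H : Matrix p n A) (G : Matrix q n A) (K : Matrix q k A) :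
    ImpliesSolvable (dualMatrix e K) (dualMatrix e G) (dualMatrix e H) (dual e M) ↔
      ImpliesSolvable H G K M := by
  constructor
  · intro h x hx
    by_contra hy
    obtain ⟨χ, hχ, hne⟩ := exists_character_ne_zero_of_notMem_range (systemMap K M) hy
    obtain ⟨t, rfl⟩ := exists_pairing_eq e χ
    obtain ⟨s, hs⟩ := h t <| pairing_injective e <| by
      ext y
      rw [← pairing_systemMap, hχ]
      simp [pairing_apply]
    rw [pairing_systemMap, ← hs, ← pairing_systemMap, hx, map_zero] at hne
    exact hne rfl
  · intro h t ht
    obtain ⟨ψ, hψ⟩ := exists_character_extension (systemMap H M)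
      ((pairing e t).comp (systemMap G M)) fun x hx => by
        obtain ⟨y, hy⟩ := h x hx
        rw [AddMonoidHom.comp_apply, ← hy, pairing_systemMap, ht]
        simp [pairing_apply]
    obtain ⟨s, rfl⟩ := exists_pairing_eq e ψ
    refine ⟨s, pairing_injective e ?_⟩
    ext x
    rw [← pairing_systemMap, hψ, AddMonoidHom.comp_apply, pairing_systemMap]

variable {e}

/-! ### The double dual -/

variable {e' : A ≃+* Bᵐᵒᵖ} (he : ∀ a, (e (e' a).unop).unop = a)
include he

/-- The condition that the identifications `e` of `B` with `Aᵐᵒᵖ` and `e'` of `A` with `Bᵐᵒᵖ` come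
from the same bijection between `A` and `B` is symmetric in `e` and `e'`. -/
theorem unop_apply_unop_apply (b : B) : (e' (e b).unop).unop = b := by
  apply e.injective
  apply MulOpposite.unop_injective
  rw [he]

theorem dualMatrix_dualMatrix (H : Matrix ι κ A) : dualMatrix e' (dualMatrix e H) = H := by
  ext i j
  refine e'.symm_apply_eq.2 (MulOpposite.unop_injective (e.symm_apply_eq.2 ?_))
  exact MulOpposite.unop_injective (he _).symm

variable (M)

/-- The evaluation map from a module to its double dual. -/
def evalDual : M →ₗ[A] dual e' (dual e M) where
  toFun m := (dualChar e' (dual e M)).symm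
    ((AddMonoidHom.eval m).comp (dualChar e M).toAddMonoidHom)
  map_add' m m' := by
    refine (dualChar e' (dual e M)).injective (DFunLike.ext _ _ fun f => ?_)
    exact map_add (dualChar e M f) m m'
  map_smul' a m := by
    refine (dualChar e' (dual e M)).injective (DFunLike.ext _ _ fun f => ?_)
    change dualChar e M f (a • m) = dualChar e M f ((e (e' a).unop).unop • m)
    rw [he]

theorem isPureMono_evalDual : IsPureMono (evalDual M he) := by
  refine isPureMono_of_systems fun m n r b ⟨y, hy⟩ => ?_
  by_contra hb
  obtain ⟨χ, hχ, hne⟩ := exists_character_ne_zero_of_notMem_range (systemMap r M) hb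
  obtain ⟨t, rfl⟩ := exists_pairing_eq e χ
  have ht : systemMap (dualMatrix e r) (dual e M) t = 0 :=
    pairing_injective e <| DFunLike.ext _ _ fun x => by
      rw [← pairing_systemMap, hχ]
      simp [pairing_apply]
  have h1 : pairing e' (evalDual M he ∘ b) t = pairing e t b := by
    rw [pairing_apply, pairing_apply]
    rfl
  rw [← h1, ← hy, ← dualMatrix_dualMatrix he r, ← pairing_systemMap, ht, map_zero] at hne
  exact hne rfl

end Dual

/-! ### Dual modules are pure-injective -/

section PureInjective

variable {A : Type u} [Ring A] {B : Type v} [Ring B] (e : B ≃+* Aᵐᵒᵖ) (M : ModuleCat.{w} A)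

/-- The map `⨁_c X → ⨁_m X`, with `c` running over the linear relations in `M` and `m` over the
elements of `M`, which sends `x` in the summand of `c` to the family `m ↦ c(m) x`. Its cokernel is
the tensor product of `X` and `M`. -/
noncomputable def relationMap (X : Type*) [AddCommGroup X] [Module B X] :
    (LinearMap.ker (Finsupp.linearCombination A (id : M → M)) →₀ X) →+ (M →₀ X) :=
  Finsupp.liftAddHom fun c =>
    { toFun := fun x => Finsupp.mapRange.addMonoidHom
        (((smulAddHom B X).flip x).comp
          (e.symm.toAddMonoidHom.comp MulOpposite.opAddEquiv.toAddMonoidHom)) c.1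
      map_zero' := by ext; simp
      map_add' := fun x y => by ext; simp }

variable {M} in
theorem relationMap_apply (X : Type*) [AddCommGroup X] [Module B X]
    (d : LinearMap.ker (Finsupp.linearCombination A (id : M → M)) →₀ X) (m : M) :
    relationMap e M X d m = d.sum fun c x => e.symm (MulOpposite.op (c.1 m)) • x := by
  simp [relationMap, Finsupp.sum, Finsupp.finsetSum_apply]

/-- A tuple over a pure submodule `L` of `X` which is zero in the tensor product of `X` and `M` is
annihilated by every homomorphism from `L` to the dual of `M`: by purity, the vanishing in the
tensor product already happens over `L`. -/
theorem sum_dualChar_eq_zero {L X : ModuleCat.{w} B} {f : L →ₗ[B] X} (hf : IsPureMono f)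
    (g : L →ₗ[B] dual e M) (l : M →₀ L)
    (hl : l.mapRange f (map_zero f) ∈ (relationMap e M X).range) :
    l.sum (fun m x => dualChar e M (g x) m) = 0 := by
  classical
  obtain ⟨d, hd⟩ := hl
  let E : Finset M := l.support ∪ d.support.biUnion fun c => c.1.support
  let H : Matrix d.support E A := fun c m => c.1.1 m
  obtain ⟨x, hx⟩ := hf.exists_solution (dualMatrix e H) (fun m : E => l m) (fun c => d c) <| by
    ext m
    refine Eq.trans ?_ (DFunLike.congr_fun hd (m : M))
    rw [relationMap_apply]
    exact Finset.sum_coe_sort d.support fun c => e.symm (MulOpposite.op (c.1 m)) • d c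
  have hH : systemMap H M (fun m => m) = 0 := by
    ext c
    have hc := c.1.2
    rw [LinearMap.mem_ker, Finsupp.linearCombination_apply,
      Finsupp.sum_of_support_subset (s := E) _
        (fun m hm => Finset.mem_union_right _ (Finset.mem_biUnion.2 ⟨c, c.2, hm⟩)) _
        (by simp)] at hc
    exact (Finset.sum_coe_sort E fun m => c.1.1 m • m).trans hc
  have hg : pairing e (g ∘ fun m : E => l m) (fun m => m) = 0 := by
    rw [← hx, ← systemMap_comp, ← pairing_systemMap, hH, map_zero]
  rw [pairing_apply] at hg
  rw [Finsupp.sum_of_support_subset (s := E) _ Finset.subset_union_left _ (by simp)]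
  exact (Finset.sum_coe_sort E fun m => dualChar e M (g (l m)) m).symm.trans hg

theorem isPureInjective_dual : IsPureInjective (dual e M) := by
  intro L X f hf g
  let π := QuotientAddGroup.mk' (relationMap e M X).range
  let χ : (M →₀ L) →+ AddCircle (1 : ℚ) := Finsupp.liftAddHom fun m =>
    (AddMonoidHom.eval m).comp ((dualChar e M).toAddMonoidHom.comp g.toAddMonoidHom)
  obtain ⟨ψ, hψ⟩ := exists_character_extension
    (π.comp (Finsupp.mapRange.addMonoidHom f.toAddMonoidHom)) χ fun l hl =>
      sum_dualChar_eq_zero e M hf g l ((QuotientAddGroup.eq_zero_iff _).1 hl)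
  have hrel : ∀ (c : LinearMap.ker (Finsupp.linearCombination A (id : M → M))) (x : X),
      π (Finsupp.mapRange.addMonoidHom (((smulAddHom B X).flip x).comp
        (e.symm.toAddMonoidHom.comp MulOpposite.opAddEquiv.toAddMonoidHom)) c.1) = 0 :=
    fun c x => (QuotientAddGroup.eq_zero_iff _).2
      ⟨Finsupp.single c x, by rw [relationMap, Finsupp.liftAddHom_apply_single]; rfl⟩
  have hadd : ∀ (m m' : M) (x : X), π (Finsupp.single (m + m') x) =
      π (Finsupp.single m x) + π (Finsupp.single m' x) := by
    intro m m' x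
    have := hrel ⟨Finsupp.single (m + m') 1 - Finsupp.single m 1 - Finsupp.single m' 1, by simp⟩ x
    simp only [map_sub, Finsupp.mapRange.addMonoidHom_apply, Finsupp.mapRange_single] at this
    simpa [sub_sub, sub_eq_zero] using this
  have hsmul : ∀ (b : B) (m : M) (x : X), π (Finsupp.single m (b • x)) =
      π (Finsupp.single ((e b).unop • m) x) := by
    intro b m x
    have := hrel ⟨Finsupp.single ((e b).unop • m) 1 - Finsupp.single m (e b).unop, by simp⟩ x
    simp only [map_sub, Finsupp.mapRange.addMonoidHom_apply, Finsupp.mapRange_single] at this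
    exact (sub_eq_zero.1 (by simpa using this)).symm
  let h : X →ₗ[B] dual e M :=
    { toFun := fun x => (dualChar e M).symm
        (AddMonoidHom.mk' (fun m => ψ (π (Finsupp.single m x))) fun m m' => by rw [hadd, map_add])
      map_add' := fun x x' => by
        refine (dualChar e M).injective (DFunLike.ext _ _ fun m => ?_)
        change ψ (π (Finsupp.single m (x + x'))) = ψ (π _) + ψ (π _)
        rw [Finsupp.single_add, map_add, map_add]
      map_smul' := fun b x => by
        refine (dualChar e M).injective (DFunLike.ext _ _ fun m => ?_)
        change ψ (π (Finsupp.single m (b • x))) = ψ (π (Finsupp.single ((e b).unop • m) x))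
        rw [hsmul] }
  refine ⟨h, LinearMap.ext fun x => (dualChar e M).injective (DFunLike.ext _ _ fun m => ?_)⟩
  have := hψ (Finsupp.single m x)
  simp only [AddMonoidHom.comp_apply, Finsupp.mapRange.addMonoidHom_apply,
    Finsupp.mapRange_single, χ, Finsupp.liftAddHom_apply_single] at this
  exact this

end PureInjective

/-! ### Dual pairs of definable classes -/

section Closure

variable {A : Type u} [Ring A]

theorem IsPureInjective.pi {I : Type w} {P : I → ModuleCat.{w} A}
    (h : ∀ i, IsPureInjective (P i)) : IsPureInjective (ModuleCat.of A (∀ i, P i)) := by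
  intro L M f hf g
  choose φ hφ using fun i => h i L M f hf (LinearMap.proj i ∘ₗ g)
  exact ⟨LinearMap.pi φ, LinearMap.ext fun x => funext fun i => LinearMap.congr_fun (hφ i) x⟩

theorem IsPureInjective.of_leftInverse {M N : ModuleCat.{w} A} (hN : IsPureInjective N)
    (s : M →ₗ[A] N) (p : N →ₗ[A] M) (h : p ∘ₗ s = LinearMap.id) : IsPureInjective M := by
  intro L X f hf g
  obtain ⟨φ, hφ⟩ := hN L X f hf (s ∘ₗ g)
  exact ⟨p ∘ₗ φ, by rw [LinearMap.comp_assoc, hφ, ← LinearMap.comp_assoc, h, LinearMap.id_comp]⟩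

theorem IsDefinable.prodClosure_le {X : ObjectProperty (ModuleCat.{w} A)} (hX : IsDefinable X)
    {Y : ObjectProperty (ModuleCat.{w} A)} (h : ∀ M, Y M → X M) (M : ModuleCat.{w} A)
    (hM : ProdClosure Y M) : X M := by
  induction hM with
  | of M hM => exact h M hM
  | pi I M _ ih => exact hX.pi_mem I M ih
  | summand M N s p hsp _ ih => exact hX.pure_mem M N s (isPureMono_of_leftInverse hsp) ih

theorem IsDefinable.prodPlus_le {X : ObjectProperty (ModuleCat.{w} A)} (hX : IsDefinable X)
    {Y : ObjectProperty (ModuleCat.{w} A)} (h : ∀ M, Y M → X M) (M : ModuleCat.{w} A)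
    (hM : ProdPlus Y M) : X M := by
  induction hM with
  | of M hM => exact h M hM
  | pi I M _ ih => exact hX.pi_mem I M ih
  | pure M N f hf _ ih => exact hX.pure_mem M N f hf ih

theorem isPureInjective_of_prodClosure {Y : ObjectProperty (ModuleCat.{w} A)}
    (h : ∀ M, Y M → IsPureInjective M) (M : ModuleCat.{w} A) (hM : ProdClosure Y M) :
    IsPureInjective M := by
  induction hM with
  | of M hM => exact h M hM
  | pi I M _ ih => exact .pi ih
  | summand M N s p hsp _ ih => exact ih.of_leftInverse s p hsp

end Closure

section DualPair

variable {A : Type u} [Ring A] {B : Type v} [Ring B] {e : B ≃+* Aᵐᵒᵖ} {e' : A ≃+* Bᵐᵒᵖ}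

/-- If each of two definable classes `S` and `D` consists of the modules whose dual lies in the
other, they form a dual pair: both are closed under double duals, and every module is a pure
submodule of its double dual, hence a direct summand of it if it is pure-injective. -/
theorem isDefinableDualPair_of_mem_iff (he : ∀ a, (e (e' a).unop).unop = a)
    {S : ObjectProperty (ModuleCat.{w} A)} {D : ObjectProperty (ModuleCat.{w} B)}
    (hS : IsDefinable S) (hD : IsDefinable D) (hSD : ∀ M, S M ↔ D (dual e M))
    (hDS : ∀ N, D N ↔ S (dual e' N)) : IsDefinableDualPair e S D := by
  have he' := unop_apply_unop_apply he
  have hdual : ∀ N, dualClass e S N → D N := by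
    rintro N ⟨M, hM, ⟨φ⟩⟩
    exact hD.pure_mem _ _ φ.toLinearMap (isPureMono_of_leftInverse φ.symm_comp)
      ((hSD M).1 hM)
  refine ⟨⟨⟨?_, fun M H j hj hM => ?_, hSD⟩, ?_⟩, hS, hD, ?_⟩
  · ext N
    exact ⟨.of N, hD.prodClosure_le (fun _ h => h) N⟩
  · obtain ⟨g, hg⟩ := isPureInjective_dual e (dual e' M) M H j hj.isPureMono (evalDual M he')
    refine hD.pure_mem _ _ g (hj.pureEssential _ g ?_) ((hSD _).1 ((hDS M).1 hM))
    rw [hg]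
    exact isPureMono_evalDual M he'
  · ext N
    refine ⟨fun h => ⟨hD.prodClosure_le hdual N h, isPureInjective_of_prodClosure ?_ N h⟩,
      fun ⟨hN, hinj⟩ => ?_⟩
    · rintro N ⟨M, -, ⟨φ⟩⟩
      exact (isPureInjective_dual e M).of_leftInverse φ.toLinearMap φ.symm.toLinearMap φ.symm_comp
    · obtain ⟨p, hp⟩ := hinj _ _ (evalDual N he') (isPureMono_evalDual N he') LinearMap.id
      exact .summand _ _ _ p hp (.of _ ⟨_, (hDS N).1 hN, ⟨LinearEquiv.refl _ _⟩⟩)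
  · ext N
    refine ⟨fun h => ⟨_, evalDual N he', isPureMono_evalDual N he', _, (hDS N).1 h,
      ⟨LinearEquiv.refl _ _⟩⟩, ?_⟩
    rintro ⟨N', f, hf, hN'⟩
    exact hD.pure_mem _ _ f hf (hdual N' hN')

end DualPair

section ElementaryDual

variable {A : Type u} [Ring A] {B : Type u} [Ring B] {e : B ≃+* Aᵐᵒᵖ} {e' : A ≃+* Bᵐᵒᵖ}

/-- Implications between linear systems pass from a module to its double dual by applying
elementary duality twice, and the class is defined by such implications. -/
theorem IsDefinable.dual_dual_mem_iff (he : ∀ a, (e (e' a).unop).unop = a)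
    {S : ObjectProperty (ModuleCat.{max u v} A)} (hS : IsDefinable S)
    (M : ModuleCat.{max u v} A) : S (dual e' (dual e M)) ↔ S M := by
  refine ⟨hS.pure_mem _ _ _ (isPureMono_evalDual M he), fun hM => ?_⟩
  refine hS.mem_of_impliesSolvable fun p n q k H G K h => ?_
  rw [← dualMatrix_dualMatrix he H, ← dualMatrix_dualMatrix he G, ← dualMatrix_dualMatrix he K,
    impliesSolvable_dual_iff, impliesSolvable_dual_iff]
  exact h M hM

/-- The modules whose dual lies in a definable class form a definable class, defined by the
elementary duals of the implications which define the given one. -/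
theorem IsDefinable.setOf_dual_mem (he : ∀ a, (e (e' a).unop).unop = a)
    {S : ObjectProperty (ModuleCat.{max u v} A)} (hS : IsDefinable S) :
    IsDefinable fun N : ModuleCat.{max u v} B => S (dual e' N) := by
  let J := {j : Σ p n q k : ℕ, Matrix (Fin p) (Fin n) A × Matrix (Fin q) (Fin n) A ×
    Matrix (Fin q) (Fin k) A // ∀ M, S M → ImpliesSolvable j.2.2.2.2.1 j.2.2.2.2.2.1
      j.2.2.2.2.2.2 M}
  refine isDefinable_of_iff_impliesSolvable (J := J) (fun j => dualMatrix e j.1.2.2.2.2.2.2)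
    (fun j => dualMatrix e j.1.2.2.2.2.2.1) (fun j => dualMatrix e j.1.2.2.2.2.1) fun N => ?_
  simp only [← impliesSolvable_dual_iff e' (M := N), dualMatrix_dualMatrix he]
  exact ⟨fun hN j => j.2 _ hN, fun hN => hS.mem_of_impliesSolvable fun p n q k H G K h =>
    hN ⟨⟨p, n, q, k, H, G, K⟩, h⟩⟩

/-- `Prod⁺(S*)` is the class of modules whose dual lies in `S`. -/
theorem IsDefinable.prodPlus_dualClass_iff (he : ∀ a, (e (e' a).unop).unop = a)
    {S : ObjectProperty (ModuleCat.{max u v} A)} (hS : IsDefinable S)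
    (N : ModuleCat.{max u v} B) : ProdPlus (dualClass e S) N ↔ S (dual e' N) := by
  have he' := unop_apply_unop_apply he
  have hD := hS.setOf_dual_mem he
  refine ⟨hD.prodPlus_le ?_ N, fun h => ?_⟩
  · rintro N ⟨M, hM, ⟨φ⟩⟩
    exact hD.pure_mem _ _ φ.toLinearMap (isPureMono_of_leftInverse φ.symm_comp)
      ((hS.dual_dual_mem_iff he M).2 hM)
  · exact .pure _ _ (evalDual N he') (isPureMono_evalDual N he')
      (.of _ ⟨_, h, ⟨LinearEquiv.refl _ _⟩⟩)

end ElementaryDual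

theorem corollary4p6 {R : Type u} [Ring R] (S : ObjectProperty (ModuleCat.{max u v} R))
    (hS : IsDefinable S) :
    IsDefinableDualPair (RingEquiv.refl Rᵐᵒᵖ) S
        (ProdPlus (dualClass (RingEquiv.refl Rᵐᵒᵖ) S)) ∧
      IsDefinableDualPair (RingEquiv.opOp R)
        (ProdPlus (dualClass (RingEquiv.refl Rᵐᵒᵖ) S)) S := by
  have he : ∀ a : R, (RingEquiv.refl Rᵐᵒᵖ (RingEquiv.opOp R a).unop).unop = a := fun _ => rfl
  have he' : ∀ a : Rᵐᵒᵖ, (RingEquiv.opOp R (RingEquiv.refl Rᵐᵒᵖ a).unop).unop = a := fun _ => rfl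
  have hDS := hS.prodPlus_dualClass_iff he
  have hSD : ∀ M, S M ↔ ProdPlus (dualClass (RingEquiv.refl Rᵐᵒᵖ) S)
      (dual (RingEquiv.refl Rᵐᵒᵖ) M) := fun M =>
    ((hDS _).trans (hS.dual_dual_mem_iff he M)).symm
  have hD : IsDefinable (ProdPlus (dualClass (RingEquiv.refl Rᵐᵒᵖ) S)) := by
    convert hS.setOf_dual_mem he
    exact hDS _
  exact ⟨isDefinableDualPair_of_mem_iff he hS hD hSD hDS,
    isDefinableDualPair_of_mem_iff he' hD hS hDS hSD⟩
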